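/- Let $0<\alpha\le 1$ and $\lambda>0$. A real-valued Lévy process is a process $(X(t))_{t\ge 0}$ with $X(0)=0$ a.s., independent and stationary increments, continuous in probability and with a.s. càdlàg paths. A Mittag-Leffler Lévy process (MLLP) is a Lévy process $M_{\alpha,\lambda}$ on a probability space with $$\mathbb{E}\,e^{-uM_{\alpha,\lambda}(t)}=\Big(\frac{\lambda}{\lambda+u^{\alpha}}\Big)^{t},\qquad u\ge 0,\ t\ge 0.$$ For $p\in(0,1)$ let $NB_p$ be a negative binomial Lévy process, i.e. a Lévy process with $$\mathbb{P}(NB_p(t)=j)=\binom{t+j-1}{j}p^{t}(1-p)^{j},\qquad j=0,1,2,\dots,\ t>0$$ (generalized binomial coefficient), and put $N_p(t)=t+NB_p(t)$. A process $X$ is called stochastically self-similar with index $\eta>0$ with respect to a family of processes $(T_c)_{c>1}$ if, for every $c>1$, the process $T_c$ is independent of $X$, $T_c(0)=0$ a.s., $T_c$ has a.s. non-decreasing paths, $\mathbb{E}\,T_c(t)=ct$ for all $t\ge0$, and $\{X(T_c(t)),\,t\ge 0\}$ and $\{c^{\eta}X(t),\,t\ge 0\}$ have the same finite-dimensional distributions.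 **Proposition.** (a) If, for every $c>1$, $N_{1/c}$ is defined on the same probability space as $M_{\alpha,\lambda}$ and is independent of it, then $M_{\alpha,\lambda}$ is stochastically self-similar with index $1/\alpha$ with respect to the family $(N_{1/c})_{c>1}$. (b) In particular, for every single $c>1$ and every such process $N_{1/c}$ independent of $M_{\alpha,\lambda}$, the processes $$\{M_{\alpha,\lambda}(N_{1/c}(t)),\ t\ge 0\}\quad\text{and}\quad\{c^{1/\alpha}M_{\alpha,\lambda}(t),\ t\ge 0\}$$ have the same finite-dimensional distributions. -/

import Mathlib

open MeasureTheory ProbabilityTheory Filter Topology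
open scoped NNReal

/-- A function on `[0, ∞)` is càdlàg: right-continuous with finite left limits at every point
(the condition on left limits is void at `0`). -/
def IsCadlagPath (f : ℝ≥0 → ℝ) : Prop :=
  ∀ t, ContinuousWithinAt f (Set.Ici t) t ∧ ∃ l : ℝ, Tendsto f (𝓝[<] t) (𝓝 l)

/-- Real-valued Lévy process `(X t)_{t ≥ 0}` on the probability space `(Ω, P)`. -/
structure IsLevyProcess {Ω : Type*} [MeasurableSpace Ω] (X : ℝ≥0 → Ω → ℝ) (P : Measure Ω) :
    Prop where
  measurable : ∀ t, Measurable (X t)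
  zero : ∀ᵐ ω ∂P, X 0 ω = 0
  indepIncrements : HasIndepIncrements X P
  stationaryIncrements : ∀ s h, IdentDistrib (X (s + h) - X s) (X h) P P
  stochContinuous : ∀ t, TendstoInMeasure P X (𝓝 t) (X t)
  cadlag : ∀ᵐ ω ∂P, IsCadlagPath (fun t => X t ω)

/-- Mittag-Leffler Lévy process (MLLP) with parameters `α` and `lam`: a Lévy process `M` with
`E exp (-u M t) = (lam / (lam + u ^ α)) ^ t` for all `u, t ≥ 0`. -/
structure IsMittagLefflerLevyProcess {Ω : Type*} [MeasurableSpace Ω] (α lam : ℝ)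
    (M : ℝ≥0 → Ω → ℝ) (P : Measure Ω) : Prop where
  isLevy : IsLevyProcess M P
  laplace : ∀ (t : ℝ≥0) (u : ℝ), 0 ≤ u →
    Integrable (fun ω => Real.exp (-u * M t ω)) P ∧
      ∫ ω, Real.exp (-u * M t ω) ∂P = (lam / (lam + u ^ α)) ^ (t : ℝ)

/-- Negative binomial Lévy process with parameter `p`: a Lévy process `NB` with
`P (NB t = j) = (t + j - 1 choose j) p ^ t (1 - p) ^ j` for `t > 0` and `j = 0, 1, 2, …`,
where the binomial coefficient is the generalized one, with real upper entry. -/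
structure IsNegBinomialLevyProcess {Ω : Type*} [MeasurableSpace Ω] (p : ℝ)
    (NB : ℝ≥0 → Ω → ℝ) (P : Measure Ω) : Prop where
  isLevy : IsLevyProcess NB P
  marginal : ∀ t : ℝ≥0, 0 < t → ∀ j : ℕ,
    P.real {ω | NB t ω = (j : ℝ)} =
      Ring.choose ((t : ℝ) + (j : ℝ) - 1) j * p ^ (t : ℝ) * (1 - p) ^ j

/-- The process `t + Y t`, that is, `Y` with unit drift. -/
def addDrift {Ω : Type*} (Y : ℝ≥0 → Ω → ℝ) (t : ℝ≥0) (ω : Ω) : ℝ :=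
  (t : ℝ) + Y t ω

/-- The process `X (T t)`, for a real-valued random time change `T`. It is used only for `T` that
is almost surely nonnegative, so that the truncation at `0` is immaterial. -/
def timeChange {Ω : Type*} (X T : ℝ≥0 → Ω → ℝ) (t : ℝ≥0) (ω : Ω) : ℝ :=
  X (Real.toNNReal (T t ω)) ω

/-- Two processes on `(Ω, P)` have the same finite-dimensional distributions. -/
def SameFDD {Ω : Type*} [MeasurableSpace Ω] (X Y : ℝ≥0 → Ω → ℝ) (P : Measure Ω) : Prop :=
  ∀ I : Finset ℝ≥0, IdentDistrib (fun ω (t : I) => X t ω) (fun ω (t : I) => Y t ω) P P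

/-- Two processes on `(Ω, P)` are independent (as random elements of `ℝ ^ [0, ∞)` with the
product σ-algebra). -/
def IndepProcesses {Ω : Type*} [MeasurableSpace Ω] (X Y : ℝ≥0 → Ω → ℝ) (P : Measure Ω) : Prop :=
  IndepFun (fun ω t => X t ω) (fun ω t => Y t ω) P

/-- The process `X` is stochastically self-similar with index `η > 0` with respect to the family
`(T c)_{c > 1}`. The values `T c` for `c ≤ 1` play no role. -/
structure IsStochSelfSimilar {Ω : Type*} [MeasurableSpace Ω] (X : ℝ≥0 → Ω → ℝ)
    (T : ℝ → ℝ≥0 → Ω → ℝ) (η : ℝ) (P : Measure Ω) : Prop where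
  index_pos : 0 < η
  measurable : ∀ t, Measurable (X t)
  measurable_time : ∀ c, 1 < c → ∀ t, Measurable (T c t)
  indep : ∀ c, 1 < c → IndepProcesses X (T c) P
  time_zero : ∀ c, 1 < c → ∀ᵐ ω ∂P, T c 0 ω = 0
  time_mono : ∀ c, 1 < c → ∀ᵐ ω ∂P, Monotone (fun t => T c t ω)
  time_mean : ∀ c, 1 < c → ∀ t, Integrable (T c t) P ∧ ∫ ω, T c t ω ∂P = c * (t : ℝ)
  selfSimilar : ∀ c, 1 < c → SameFDD (timeChange X (T c)) (fun t ω => c ^ η * X t ω) P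

/-! Write φ(u) = λ/(λ + u^α), so that M(t) has Laplace transform φ(u)^t. The clock t + NB(t) has
generating function (pz/(1 - (1 - p)z))^t. Conditioning on the clock, M at the changed time has
transform (pφ/(1 - (1 - p)φ))^t. For p = 1/c this Möbius map sends λ/(λ + v) to λ/(λ + cv), and c
u^α = (c^(1/α) u)^α, so the result is the transform of c^(1/α) M(t) (`mittagLefflerBase_scale`).

For finite-dimensional laws the same computation runs factor by factor over increments: freezing the
clock turns a time grid into another monotone grid, on which M has independent stationary
increments, and the increments of NB are in turn independent and stationary
(`lintegral_prod_exp_timeChange`). Equality of joint transforms gives equality of laws by a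
Stone–Weierstrass argument on the nonnegative orthant; nonnegativity itself follows because the
transforms are at most 1 (`identDistrib_of_lintegral_exp_eq`).

Self-similarity also needs the clock to be monotone, by right-continuity, and to have mean t + t(1 -
p)/p = ct. -/

/-! ### Uniqueness of multivariate Laplace transforms -/

section Laplace

variable {ι : Type*} [Fintype ι]

/-- The function `x ↦ exp (-⟨u, x⟩)` on the nonnegative orthant, as a bounded continuous
function. -/
noncomputable def expNegDot (u : ι → ℝ≥0) : BoundedContinuousFunction (ι → ℝ≥0) ℝ :=
  BoundedContinuousFunction.ofNormedAddCommGroup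
    (fun x => Real.exp (-∑ i, (u i : ℝ) * (x i : ℝ))) (by fun_prop) 1 (by
      intro x
      rw [Real.norm_eq_abs, abs_of_pos (Real.exp_pos _), Real.exp_le_one_iff, neg_nonpos]
      positivity)

lemma expNegDot_apply (u x : ι → ℝ≥0) :
    expNegDot u x = Real.exp (-∑ i, (u i : ℝ) * (x i : ℝ)) := rfl

/-- The functions `x ↦ exp (-⟨u, x⟩)` form a multiplicative submonoid. -/
noncomputable def expNegDotSubmonoid (ι : Type*) [Fintype ι] :
    Submonoid (BoundedContinuousFunction (ι → ℝ≥0) ℝ) where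
  carrier := Set.range expNegDot
  one_mem' := ⟨0, by ext x; simp [expNegDot_apply]⟩
  mul_mem' := by
    rintro _ _ ⟨u, rfl⟩ ⟨v, rfl⟩
    refine ⟨u + v, ?_⟩
    ext x
    simp only [BoundedContinuousFunction.coe_mul, Pi.mul_apply, expNegDot_apply]
    rw [← Real.exp_add, ← neg_add, ← Finset.sum_add_distrib]
    simp [add_mul]

/-- The star algebra generated by the functions `x ↦ exp (-⟨u, x⟩)`. -/
noncomputable def expNegDotAlgebra (ι : Type*) [Fintype ι] :
    StarSubalgebra ℝ (BoundedContinuousFunction (ι → ℝ≥0) ℝ) :=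
  { Algebra.adjoin ℝ (Set.range (expNegDot (ι := ι))) with
    star_mem' := by
      intro f hf
      have : star f = f := by ext x; simp
      rwa [this] }

/-- A finite measure on the nonnegative orthant is determined by its Laplace transform. -/
theorem MeasureTheory.Measure.ext_of_integral_expNegDot {μ ν : Measure (ι → ℝ≥0)}
    [IsFiniteMeasure μ] [IsFiniteMeasure ν]
    (h : ∀ u : ι → ℝ≥0, ∫ x, expNegDot u x ∂μ = ∫ x, expNegDot u x ∂ν) : μ = ν := by
  classical
  -- A point-separating star subalgebra of bounded continuous functions determines a finite measure
  -- on a Polish space. The exponentials are closed under products, so their linear span is already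
  -- the algebra and linearity of the integral suffices.
  refine ext_of_forall_mem_subalgebra_integral_eq_of_polish (𝕜 := ℝ)
    (A := expNegDotAlgebra ι) ?_ ?_
  · intro x y hxy
    obtain ⟨i, hi⟩ := Function.ne_iff.1 hxy
    refine ⟨_, ⟨_, ⟨expNegDot (Pi.single i 1), Algebra.subset_adjoin ⟨_, rfl⟩, rfl⟩, rfl⟩, ?_⟩
    have hval : ∀ z : ι → ℝ≥0, expNegDot (Pi.single i 1) z = Real.exp (-(z i : ℝ)) := by
      intro z
      rw [expNegDot_apply, Finset.sum_eq_single i]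
      · simp
      · intro j _ hj
        simp [hj]
      · simp
    change expNegDot (Pi.single i 1) x ≠ expNegDot (Pi.single i 1) y
    simpa [hval] using hi
  · intro g hg
    have hg' : g ∈ Algebra.adjoin ℝ (Set.range (expNegDot (ι := ι))) := hg
    rw [← Subalgebra.mem_toSubmodule, Algebra.adjoin_eq_span,
      show Submonoid.closure (Set.range (expNegDot (ι := ι))) = expNegDotSubmonoid ι from
        Submonoid.closure_eq (expNegDotSubmonoid ι)] at hg'
    clear hg
    induction hg' using Submodule.span_induction with
    | mem g hg =>
      obtain ⟨u, rfl⟩ := hg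
      exact h u
    | zero => simp
    | add f g _ _ hf hg =>
      simp only [BoundedContinuousFunction.coe_add, Pi.add_apply]
      rw [integral_add (f.integrable _) (g.integrable _),
        integral_add (f.integrable _) (g.integrable _), hf, hg]
    | smul a f _ hf =>
      simp only [BoundedContinuousFunction.coe_smul, integral_smul, hf]

variable {Ω : Type*} [MeasurableSpace Ω] {P : Measure Ω}

/-- A random variable with Laplace transform at most `1` is almost surely nonnegative. -/
theorem ae_nonneg_of_lintegral_exp_le_one {X : Ω → ℝ} (hX : AEMeasurable X P)
    (h : ∀ u : ℝ, 0 ≤ u → ∫⁻ ω, ENNReal.ofReal (Real.exp (-u * X ω)) ∂P ≤ 1) :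
    ∀ᵐ ω ∂P, 0 ≤ X ω := by
  -- Chernoff bound: exp(kε) P(X ≤ -ε) ≤ 1 for all k forces P(X ≤ -ε) = 0.
  have key : ∀ n : ℕ, ∀ᵐ ω ∂P, -(1 / ((n : ℝ) + 1)) < X ω := by
    intro n
    set ε : ℝ := 1 / ((n : ℝ) + 1) with hε
    have hε0 : 0 < ε := by positivity
    have hle : ∀ k : ℕ, ENNReal.ofReal (Real.exp (k * ε)) * P {ω | X ω ≤ -ε} ≤ 1 := by
      intro k
      refine le_trans ?_ (h k k.cast_nonneg)
      refine le_trans ?_ (mul_meas_ge_le_lintegral₀ (by fun_prop)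
        (ENNReal.ofReal (Real.exp (k * ε))))
      refine mul_le_mul_right (measure_mono fun ω hω => ?_) _
      simp only [Set.mem_ofPred_eq] at hω ⊢
      refine ENNReal.ofReal_le_ofReal (Real.exp_le_exp.2 ?_)
      have : (k : ℝ) * ε ≤ k * (-X ω) := by gcongr; linarith
      linarith
    have hzero : P {ω | X ω ≤ -ε} = 0 := by
      by_contra hne
      have ht : Tendsto (fun k : ℕ => ENNReal.ofReal (Real.exp (k * ε)) * P {ω | X ω ≤ -ε}) atTop
          (𝓝 (⊤ * P {ω | X ω ≤ -ε})) := by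
        refine ENNReal.Tendsto.mul_const ?_ (Or.inl ENNReal.top_ne_zero)
        exact ENNReal.tendsto_ofReal_atTop.comp (Real.tendsto_exp_atTop.comp
          (tendsto_natCast_atTop_atTop.atTop_mul_const hε0))
      rw [ENNReal.top_mul hne] at ht
      exact absurd (le_of_tendsto' ht hle) (by simp)
    simpa [ae_iff, not_lt] using hzero
  filter_upwards [ae_all_iff.2 key] with ω hω
  have h1 : Tendsto (fun n : ℕ => -(1 / ((n : ℝ) + 1))) atTop (𝓝 (-0)) :=
    tendsto_one_div_add_atTop_nhds_zero_nat.neg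
  rw [neg_zero] at h1
  exact le_of_tendsto' h1 fun n => (hω n).le

/-- Random vectors whose Laplace transforms agree and are at most `1` have the same law. -/
theorem identDistrib_of_lintegral_exp_eq [IsProbabilityMeasure P] {A B : Ω → ι → ℝ}
    (hA : AEMeasurable A P) (hB : AEMeasurable B P)
    (h : ∀ u : ι → ℝ, 0 ≤ u → ∫⁻ ω, ∏ i, ENNReal.ofReal (Real.exp (-u i * A ω i)) ∂P =
      ∫⁻ ω, ∏ i, ENNReal.ofReal (Real.exp (-u i * B ω i)) ∂P)
    (hle : ∀ u : ι → ℝ, 0 ≤ u → ∫⁻ ω, ∏ i, ENNReal.ofReal (Real.exp (-u i * A ω i)) ∂P ≤ 1) :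
    IdentDistrib A B P P := by
  classical
  have nonneg : ∀ C : Ω → ι → ℝ, AEMeasurable C P →
      (∀ u : ι → ℝ, 0 ≤ u → ∫⁻ ω, ∏ i, ENNReal.ofReal (Real.exp (-u i * C ω i)) ∂P ≤ 1) →
      ∀ᵐ ω ∂P, ∀ i, 0 ≤ C ω i := by
    intro C hC hC1
    refine ae_all_iff.2 fun i => ae_nonneg_of_lintegral_exp_le_one (by fun_prop) fun u hu => ?_
    refine le_trans (le_of_eq ?_) (hC1 (Pi.single i u) (Pi.single_nonneg.2 hu))
    refine lintegral_congr fun ω => ?_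
    rw [Finset.prod_eq_single i]
    · simp
    · intro j _ hj
      simp [hj]
    · simp
  have hA0 := nonneg A hA hle
  have hB0 := nonneg B hB fun u hu => (h u hu).symm.le.trans (hle u hu)
  -- Laplace uniqueness lives on the orthant: the laws are pushed there by `pos` and brought back by
  -- `emb`, which inverts it almost surely.
  set pos : (ι → ℝ) → ι → ℝ≥0 := fun x i => (x i).toNNReal with hpos
  have hposm : Measurable pos := by fun_prop
  set emb : (ι → ℝ≥0) → ι → ℝ := fun x i => (x i : ℝ) with hemb
  have hembm : Measurable emb := by fun_prop
  have int_eq : ∀ C : Ω → ι → ℝ, AEMeasurable C P → (∀ᵐ ω ∂P, ∀ i, 0 ≤ C ω i) →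
      ∀ u : ι → ℝ≥0, ∫ x, expNegDot u x ∂(P.map (pos ∘ C)) =
        (∫⁻ ω, ∏ i, ENNReal.ofReal (Real.exp (-(u i : ℝ) * C ω i)) ∂P).toReal := by
    intro C hC hC0 u
    have hpC : AEMeasurable (fun ω => pos (C ω)) P := hposm.comp_aemeasurable hC
    rw [integral_map (hposm.comp_aemeasurable hC)
        (expNegDot u).continuous.aestronglyMeasurable,
      integral_eq_lintegral_of_nonneg_ae
        (f := fun ω => expNegDot u ((pos ∘ C) ω)) (ae_of_all _ fun ω => (Real.exp_pos _).le)
        (by exact ((expNegDot u).continuous.measurable.comp_aemeasurable hpC).aestronglyMeasurable)]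
    congr 1
    refine lintegral_congr_ae ?_
    filter_upwards [hC0] with ω hω
    rw [← ENNReal.ofReal_prod_of_nonneg fun i _ => (Real.exp_pos _).le, ← Real.exp_sum,
      expNegDot_apply]
    simp [hpos, Real.coe_toNNReal _ (hω _)]
  have hmap : P.map (pos ∘ A) = P.map (pos ∘ B) := by
    have := Measure.isProbabilityMeasure_map (μ := P) (hposm.comp_aemeasurable hA)
    have := Measure.isProbabilityMeasure_map (μ := P) (hposm.comp_aemeasurable hB)
    refine Measure.ext_of_integral_expNegDot fun u => ?_
    rw [int_eq A hA hA0, int_eq B hB hB0, h (fun i => u i) fun i => (u i).2]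
  have hid : IdentDistrib (pos ∘ A) (pos ∘ B) P P :=
    ⟨hposm.comp_aemeasurable hA, hposm.comp_aemeasurable hB, hmap⟩
  have back : ∀ C : Ω → ι → ℝ, (∀ᵐ ω ∂P, ∀ i, 0 ≤ C ω i) → emb ∘ pos ∘ C =ᵐ[P] C := by
    intro C hC0
    filter_upwards [hC0] with ω hω
    ext i
    simp [hemb, hpos, hω i]
  have := hid.comp hembm
  exact ⟨hA, hB, by
    rw [← Measure.map_congr (back A hA0), ← Measure.map_congr (back B hB0)]
    exact this.map_eq⟩

end Laplace

/-! ### Series for the negative binomial law -/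

/-- The negative binomial series. -/
theorem hasSum_choose_mul_pow (a : ℝ) {x : ℝ} (hx : |x| < 1) :
    HasSum (fun n : ℕ => Ring.choose (a + n - 1) n * x ^ n) (1 / (1 - x) ^ a) := by
  have h := (Real.one_div_one_sub_rpow_hasFPowerSeriesOnBall_zero a).hasSum (y := x)
    (by simpa [enorm_eq_nnnorm, ← NNReal.coe_lt_one] using hx)
  simpa [FormalMultilinearSeries.ofScalars_apply_eq, mul_comm] using h

/-- Comes from the rising factorial identity (a)_{n+1} = a (a + 1)_n. It turns the mean series with
parameter a into the negative binomial series with parameter a + 1. -/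
lemma natCast_succ_mul_choose (a : ℝ) (n : ℕ) :
    ((n + 1 : ℕ) : ℝ) * Ring.choose (a + ((n + 1 : ℕ) : ℝ) - 1) (n + 1) =
      a * Ring.choose ((a + 1) + n - 1) n := by
  rw [← Ring.multichoose_eq, ← Ring.multichoose_eq]
  have h1 := Ring.factorial_nsmul_multichoose_eq_ascPochhammer a (n + 1)
  have h2 := Ring.factorial_nsmul_multichoose_eq_ascPochhammer (a + 1) n
  rw [ascPochhammer_succ_left, Polynomial.smeval_X_mul, Polynomial.smeval_comp,
    Polynomial.smeval_add, Polynomial.smeval_X, Polynomial.smeval_one] at h1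
  have hn : (n.factorial : ℝ) ≠ 0 := by positivity
  apply mul_left_cancel₀ hn
  simp only [nsmul_eq_mul, Nat.factorial_succ, pow_one, pow_zero, one_smul] at h1 h2
  push_cast at h1 ⊢
  rw [← h2] at h1
  linear_combination h1

/-- The series for the mean of the negative binomial distribution. -/
theorem hasSum_natCast_mul_choose_mul_pow (a : ℝ) {x : ℝ} (hx : |x| < 1) :
    HasSum (fun n : ℕ => (n : ℝ) * (Ring.choose (a + n - 1) n * x ^ n))
      (a * x / (1 - x) ^ (a + 1)) := by
  rw [← hasSum_nat_add_iff' 1]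
  have h0 : a * x / (1 - x) ^ (a + 1) -
      ∑ i ∈ Finset.range 1, (i : ℝ) * (Ring.choose (a + i - 1) i * x ^ i) =
      a * x * (1 / (1 - x) ^ (a + 1)) := by
    rw [Finset.sum_range_one, Nat.cast_zero, zero_mul, sub_zero, mul_one_div]
  rw [h0]
  convert! ((hasSum_choose_mul_pow (a + 1) hx).mul_left (a * x)) using 2 with n
  rw [← mul_assoc, natCast_succ_mul_choose, pow_succ]
  ring

/-! ### Law, mean and monotonicity of the negative binomial process -/

section NegBinomial

variable {Ω : Type*} [MeasurableSpace Ω] {P : Measure Ω}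

lemma IsLevyProcess.increment_identDistrib {X : ℝ≥0 → Ω → ℝ} (hX : IsLevyProcess X P)
    {s t : ℝ≥0} (hst : s ≤ t) :
    IdentDistrib (fun ω => X t ω - X s ω) (X (t - s)) P P := by
  have := hX.stationaryIncrements s (t - s)
  rwa [add_tsub_cancel_of_le hst] at this

/-- Independence and stationarity of the increments of a Lévy process, in terms of product
functionals. -/
theorem IsLevyProcess.lintegral_prod_increments {X : ℝ≥0 → Ω → ℝ} (hX : IsLevyProcess X P)
    {k : ℕ} {t : Fin (k + 1) → ℝ≥0} (ht : Monotone t) {g : Fin k → ℝ → ENNReal}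
    (hg : ∀ i, Measurable (g i)) :
    ∫⁻ ω, ∏ i, g i (X (t i.succ) ω - X (t i.castSucc) ω) ∂P =
      ∏ i, ∫⁻ ω, g i (X (t i.succ - t i.castSucc) ω) ∂P := by
  have hind := (hX.indepIncrements k t ht).comp g hg
  refine (lintegral_prod_eq_prod_lintegral_of_indepFun Finset.univ _ hind fun i => ?_).trans ?_
  · exact (hg i).comp ((hX.measurable _).sub (hX.measurable _))
  · refine Finset.prod_congr rfl fun i _ => ?_
    exact ((hX.increment_identDistrib (ht i.castSucc_le_succ)).comp (hg i)).lintegral_eq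

variable {p : ℝ} {NB : ℝ≥0 → Ω → ℝ}

/-- The negative binomial series at 1 - p equals p^(-t). Hence the prescribed atoms exhaust the
total mass, which is what makes the process integer-valued. -/
lemma IsNegBinomialLevyProcess.hasSum_marginal (h : IsNegBinomialLevyProcess p NB P)
    (hp : 0 < p) (hp1 : p < 1) {t : ℝ≥0} (ht : 0 < t) :
    HasSum (fun n : ℕ => P.real {ω | NB t ω = n}) 1 := by
  have h1 := (hasSum_choose_mul_pow t (x := 1 - p)
    (by rw [abs_lt]; constructor <;> linarith)).mul_right (p ^ (t : ℝ))
  have h2 : 1 / (1 - (1 - p)) ^ (t : ℝ) * p ^ (t : ℝ) = 1 := by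
    rw [sub_sub_cancel, one_div, inv_mul_cancel₀ (Real.rpow_pos_of_pos hp _).ne']
  rw [h2] at h1
  convert! h1 using 2 with n
  rw [h.marginal t ht n]
  ring

/-- A negative binomial Lévy process takes values in the natural numbers. -/
theorem IsNegBinomialLevyProcess.ae_eq_natFloor [IsProbabilityMeasure P]
    (h : IsNegBinomialLevyProcess p NB P) (hp : 0 < p) (hp1 : p < 1) (t : ℝ≥0) :
    ∀ᵐ ω ∂P, NB t ω = (⌊NB t ω⌋₊ : ℝ) := by
  have hm : ∀ n : ℕ, MeasurableSet {ω | NB t ω = n} := fun n =>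
    measurableSet_eq_fun (h.isLevy.measurable t) measurable_const
  -- The marginals are prescribed only for t > 0; time 0 is covered by the initial condition.
  rcases eq_zero_or_pos t with rfl | ht
  · filter_upwards [h.isLevy.zero] with ω hω
    simp [hω]
  have hone : P (⋃ n : ℕ, {ω | NB t ω = n}) = 1 := by
    rw [measure_iUnion _ hm]
    · have hs := h.hasSum_marginal hp hp1 ht
      rw [← ENNReal.ofReal_one, ← hs.tsum_eq,
        ENNReal.ofReal_tsum_of_nonneg (fun _ => measureReal_nonneg) hs.summable]
      simp
    · intro m n hmn
      refine Set.disjoint_left.2 fun ω h1 h2 => hmn ?_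
      simp only [Set.mem_ofPred_eq] at h1 h2
      exact_mod_cast h1.symm.trans h2
  filter_upwards [(mem_ae_iff_prob_eq_one (MeasurableSet.iUnion hm)).2 hone] with ω hω
  obtain ⟨n, hn⟩ := Set.mem_iUnion.1 hω
  simp only [Set.mem_ofPred_eq] at hn
  simp [hn]

theorem IsNegBinomialLevyProcess.ae_nonneg [IsProbabilityMeasure P]
    (h : IsNegBinomialLevyProcess p NB P) (hp : 0 < p) (hp1 : p < 1) (t : ℝ≥0) :
    ∀ᵐ ω ∂P, 0 ≤ NB t ω := by
  filter_upwards [h.ae_eq_natFloor hp hp1 t] with ω hω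
  rw [hω]
  positivity

/-- The expectation of a nonnegative functional of a negative binomial Lévy process at a positive
time, as a series. -/
theorem IsNegBinomialLevyProcess.lintegral_comp [IsProbabilityMeasure P]
    (h : IsNegBinomialLevyProcess p NB P) (hp : 0 < p) (hp1 : p < 1) {t : ℝ≥0} (ht : 0 < t)
    {f : ℝ → ℝ} (hf : ∀ n : ℕ, 0 ≤ f n) {S : ℝ}
    (hS : HasSum (fun n : ℕ => f n * (Ring.choose ((t : ℝ) + n - 1) n * (1 - p) ^ n)) S) :
    ∫⁻ ω, ENNReal.ofReal (f (NB t ω)) ∂P = ENNReal.ofReal (S * p ^ (t : ℝ)) := by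
  have hN : Measurable fun ω => ⌊NB t ω⌋₊ := (h.isLevy.measurable t).nat_floor
  have hae := h.ae_eq_natFloor hp hp1 t
  have hlaw : ∀ n : ℕ, P.map (fun ω => ⌊NB t ω⌋₊) {n} =
      ENNReal.ofReal (P.real {ω | NB t ω = n}) := by
    intro n
    rw [Measure.map_apply hN (measurableSet_singleton n), ofReal_measureReal]
    refine measure_congr ?_
    filter_upwards [hae] with ω hω
    refine propext ⟨fun hn => ?_, fun hn => ?_⟩
    · have hn' : ⌊NB t ω⌋₊ = n := hn
      change NB t ω = n
      rw [hω, hn']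
    · have hn' : NB t ω = n := hn
      change ⌊NB t ω⌋₊ = n
      simp [hn']
  calc ∫⁻ ω, ENNReal.ofReal (f (NB t ω)) ∂P
      = ∫⁻ ω, ENNReal.ofReal (f (⌊NB t ω⌋₊ : ℝ)) ∂P := by
        refine lintegral_congr_ae ?_
        filter_upwards [hae] with ω hω
        rw [← hω]
    _ = ∫⁻ n, ENNReal.ofReal (f (n : ℝ)) ∂(P.map (fun ω => ⌊NB t ω⌋₊)) :=
        (lintegral_map (f := fun n : ℕ => ENNReal.ofReal (f (n : ℝ)))
          (measurable_of_countable _) hN).symm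
    _ = ∑' n : ℕ, ENNReal.ofReal (f n * P.real {ω | NB t ω = n}) := by
        rw [lintegral_countable']
        refine tsum_congr fun n => ?_
        rw [hlaw, ENNReal.ofReal_mul (hf n)]
    _ = ENNReal.ofReal (S * p ^ (t : ℝ)) := by
        have hS' : HasSum (fun n : ℕ => f n * P.real {ω | NB t ω = n}) (S * p ^ (t : ℝ)) := by
          convert! (hS.mul_right (p ^ (t : ℝ))) using 2 with n
          rw [h.marginal t ht n]
          ring
        rw [← hS'.tsum_eq, ENNReal.ofReal_tsum_of_nonneg
          (fun n => mul_nonneg (hf n) measureReal_nonneg) hS'.summable]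

/-- The probability generating function of a negative binomial Lévy process. -/
theorem IsNegBinomialLevyProcess.lintegral_rpow [IsProbabilityMeasure P]
    (h : IsNegBinomialLevyProcess p NB P) (hp : 0 < p) (hp1 : p < 1) (t : ℝ≥0) {z : ℝ}
    (hz : 0 < z) (hz1 : z ≤ 1) :
    ∫⁻ ω, ENNReal.ofReal (z ^ NB t ω) ∂P =
      ENNReal.ofReal ((p / (1 - (1 - p) * z)) ^ (t : ℝ)) := by
  rcases eq_zero_or_pos t with rfl | ht
  · rw [lintegral_congr_ae (g := fun _ => 1)]
    · simp
    · filter_upwards [h.isLevy.zero] with ω hω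
      simp [hω]
  have hlt : (1 - p) * z < 1 := by nlinarith
  have hpos : 0 ≤ (1 - p) * z := mul_nonneg (by linarith) hz.le
  have hs := hasSum_choose_mul_pow t (x := (1 - p) * z) (by rw [abs_lt]; constructor <;> linarith)
  rw [h.lintegral_comp hp hp1 ht (f := fun x => z ^ x) (fun n => (Real.rpow_pos_of_pos hz _).le)
    (S := 1 / (1 - (1 - p) * z) ^ (t : ℝ)), Real.div_rpow hp.le (by linarith), one_div_mul_eq_div]
  convert! hs using 2 with n
  simp only [Real.rpow_natCast, mul_pow]
  ring

/-- The mean of a negative binomial Lévy process. -/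
theorem IsNegBinomialLevyProcess.integrable_and_integral [IsProbabilityMeasure P]
    (h : IsNegBinomialLevyProcess p NB P) (hp : 0 < p) (hp1 : p < 1) (t : ℝ≥0) :
    Integrable (NB t) P ∧ ∫ ω, NB t ω ∂P = t * (1 - p) / p := by
  have h0 := h.ae_nonneg hp hp1 t
  have hm : AEStronglyMeasurable (NB t) P := (h.isLevy.measurable t).aestronglyMeasurable
  have hlint : ∫⁻ ω, ENNReal.ofReal (NB t ω) ∂P = ENNReal.ofReal (t * (1 - p) / p) := by
    rcases eq_zero_or_pos t with rfl | ht
    · rw [lintegral_congr_ae (g := fun _ => 0)]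
      · simp
      · filter_upwards [h.isLevy.zero] with ω hω
        simp [hω]
    rw [h.lintegral_comp hp hp1 ht (f := fun x => x) (fun n => n.cast_nonneg)
      (hasSum_natCast_mul_choose_mul_pow t (by rw [abs_lt]; constructor <;> linarith))]
    congr 1
    have := (Real.rpow_pos_of_pos hp (t : ℝ)).ne'
    rw [sub_sub_cancel, Real.rpow_add hp, Real.rpow_one]
    field_simp
  refine ⟨⟨hm, ?_⟩, ?_⟩
  · rw [hasFiniteIntegral_iff_ofReal h0, hlint]
    exact ENNReal.ofReal_lt_top
  · rw [integral_eq_lintegral_of_nonneg_ae h0 hm, hlint, ENNReal.toReal_ofReal]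
    have : 0 ≤ 1 - p := by linarith
    positivity

/-- The increment has the law of `NB (t - s)`, which is nonnegative. The null set still depends on s
and t. -/
theorem IsNegBinomialLevyProcess.ae_le [IsProbabilityMeasure P]
    (h : IsNegBinomialLevyProcess p NB P) (hp : 0 < p) (hp1 : p < 1) {s t : ℝ≥0} (hst : s ≤ t) :
    ∀ᵐ ω ∂P, NB s ω ≤ NB t ω := by
  have := ((h.isLevy.increment_identDistrib hst).symm.ae_mem_snd measurableSet_Ici)
    (h.ae_nonneg hp hp1 (t - s))
  filter_upwards [this] with ω hω
  simpa using hω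

/-- A negative binomial Lévy process has almost surely nondecreasing paths. -/
theorem IsNegBinomialLevyProcess.ae_monotone [IsProbabilityMeasure P]
    (h : IsNegBinomialLevyProcess p NB P) (hp : 0 < p) (hp1 : p < 1) :
    ∀ᵐ ω ∂P, Monotone fun t => NB t ω := by
  -- A countable dense set of times gives a single null set; right-continuity then extends the
  -- inequality to all times. Limits are taken only along D, hence the `Frequently` filters.
  obtain ⟨D, hDc, hD⟩ := TopologicalSpace.exists_countable_dense ℝ≥0
  have hmono : ∀ᵐ ω ∂P, ∀ s ∈ D, ∀ t ∈ D, s ≤ t → NB s ω ≤ NB t ω := by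
    refine (ae_ball_iff hDc).2 fun s _ => (ae_ball_iff hDc).2 fun t _ => ?_
    by_cases hst : s ≤ t
    · filter_upwards [h.ae_le hp hp1 hst] with ω hω _ using hω
    · exact ae_of_all _ fun ω hst' => absurd hst' hst
  have hclose : ∀ t : ℝ≥0, ∃ᶠ s in 𝓝[>] t, s ∈ D := by
    intro t
    refine (nhdsGT_basis t).frequently_iff.2 fun b hb => ?_
    obtain ⟨x, hxD, hx⟩ := hD.exists_between hb
    exact ⟨x, hx, hxD⟩
  filter_upwards [hmono, h.isLevy.cadlag] with ω hω hcad s t hst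
  rcases hst.eq_or_lt with rfl | hlt
  · rfl
  have hright : ∀ t, Tendsto (fun t => NB t ω) (𝓝[>] t) (𝓝 (NB t ω)) := fun t =>
    (hcad t).1.mono_left (nhdsWithin_mono _ Set.Ioi_subset_Ici_self)
  have hleft : ∀ d ∈ D, s < d → NB s ω ≤ NB d ω := fun d hd hsd =>
    le_of_tendsto_of_frequently (hright s) (((hclose s).and_eventually
      (Ioo_mem_nhdsGT hsd)).mono fun x hx => hω x hx.1 d hd hx.2.2.le)
  exact ge_of_tendsto_of_frequently (hright t) (((hclose t).and_eventually
    self_mem_nhdsWithin).mono fun x hx => hleft x hx.1 (hlt.trans hx.2))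

end NegBinomial

/-! ### Laplace transform of the time-changed process -/

section TimeChange

variable {Ω : Type*} [MeasurableSpace Ω] {P : Measure Ω}

/-- Fubini's theorem for a functional of two independent random elements. -/
theorem ProbabilityTheory.IndepFun.lintegral_comp_eq [IsProbabilityMeasure P] {β γ : Type*}
    [MeasurableSpace β] [MeasurableSpace γ] {A : Ω → β} {B : Ω → γ} (h : IndepFun A B P) (hA : Measurable A)
    (hB : Measurable B) {F : β × γ → ENNReal} (hF : Measurable F) :
    ∫⁻ ω, F (A ω, B ω) ∂P = ∫⁻ ω', ∫⁻ ω, F (A ω, B ω') ∂P ∂P := by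
  have hprod := (indepFun_iff_map_prod_eq_prod_map_map hA.aemeasurable hB.aemeasurable).1 h
  have := Measure.isProbabilityMeasure_map (μ := P) hA.aemeasurable
  have := Measure.isProbabilityMeasure_map (μ := P) hB.aemeasurable
  rw [← lintegral_map (f := F) hF (hA.prodMk hB), hprod, lintegral_prod_symm' F hF,
    lintegral_map hF.lintegral_prod_left' hB]
  refine lintegral_congr fun ω' => ?_
  exact lintegral_map (hF.comp measurable_prodMk_right) hA

variable {α lam c : ℝ} {M NB : ℝ≥0 → Ω → ℝ}

/-- The base `lam / (lam + u ^ α)` of the Laplace transform of a Mittag-Leffler Lévy process. -/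
noncomputable def mittagLefflerBase (α lam u : ℝ) : ℝ := lam / (lam + u ^ α)

lemma mittagLefflerBase_pos (hlam : 0 < lam) {u : ℝ} (hu : 0 ≤ u) :
    0 < mittagLefflerBase α lam u :=
  div_pos hlam (add_pos_of_pos_of_nonneg hlam (Real.rpow_nonneg hu α))

lemma mittagLefflerBase_le_one (hlam : 0 < lam) {u : ℝ} (hu : 0 ≤ u) :
    mittagLefflerBase α lam u ≤ 1 := by
  have := Real.rpow_nonneg hu α
  exact (div_le_one (by linarith)).2 (by linarith)

/-- The Möbius identity at the heart of the proof: the left side is the generating function at time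
1 of the clock with p = 1/c, evaluated at the Mittag-Leffler base. -/
lemma mittagLefflerBase_scale (hα : α ≠ 0) (hlam : 0 < lam) (hc : 0 < c) {u : ℝ} (hu : 0 ≤ u) :
    mittagLefflerBase α lam u *
        (1 / c / (1 - (1 - 1 / c) * mittagLefflerBase α lam u)) =
      mittagLefflerBase α lam (c ^ (1 / α) * u) := by
  have hv := Real.rpow_nonneg hu α
  have h1 : lam + u ^ α ≠ 0 := by positivity
  have h2 : lam + c * u ^ α ≠ 0 := by positivity
  rw [mittagLefflerBase, mittagLefflerBase, Real.mul_rpow (by positivity) hu, ← Real.rpow_mul hc.le,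
    one_div_mul_cancel hα, Real.rpow_one]
  have h3 : 1 - (1 - 1 / c) * (lam / (lam + u ^ α)) =
      (lam + c * u ^ α) / (c * (lam + u ^ α)) := by
    field_simp
    ring
  rw [h3]
  field_simp

lemma IsMittagLefflerLevyProcess.lintegral_exp (hM : IsMittagLefflerLevyProcess α lam M P)
    (t : ℝ≥0) {u : ℝ} (hu : 0 ≤ u) :
    ∫⁻ ω, ENNReal.ofReal (Real.exp (-u * M t ω)) ∂P =
      ENNReal.ofReal (mittagLefflerBase α lam u ^ (t : ℝ)) := by
  obtain ⟨h1, h2⟩ := hM.laplace t u hu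
  rw [← ofReal_integral_eq_lintegral_ofReal h1 (ae_of_all _ fun _ => (Real.exp_pos _).le), h2,
    mittagLefflerBase]

/-- The joint Laplace transform of the increments of a Mittag-Leffler Lévy process. -/
theorem IsMittagLefflerLevyProcess.lintegral_prod_exp
    (hM : IsMittagLefflerLevyProcess α lam M P) {k : ℕ} {t : Fin (k + 1) → ℝ≥0} (ht : Monotone t)
    {u : Fin k → ℝ} (hu : 0 ≤ u) :
    ∫⁻ ω, ∏ i, ENNReal.ofReal
        (Real.exp (-u i * (M (t i.succ) ω - M (t i.castSucc) ω))) ∂P =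
      ∏ i, ENNReal.ofReal
        (mittagLefflerBase α lam (u i) ^ ((t i.succ : ℝ) - t i.castSucc)) := by
  rw [hM.isLevy.lintegral_prod_increments ht
    (g := fun i x => ENNReal.ofReal (Real.exp (-u i * x))) (fun i => by fun_prop)]
  refine Finset.prod_congr rfl fun i _ => ?_
  rw [hM.lintegral_exp _ (hu i), NNReal.coe_sub (ht i.castSucc_le_succ)]

variable [IsProbabilityMeasure P]

/-- At fixed times, the time change by a negative binomial Lévy process with unit drift only
involves shifts by natural numbers. -/
lemma timeChange_ae_eq (hc : 1 < c) (hNB : IsNegBinomialLevyProcess (1 / c) NB P) (t : ℝ≥0) :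
    ∀ᵐ ω ∂P, timeChange M (addDrift NB) t ω = M (t + (⌊NB t ω⌋₊ : ℝ≥0)) ω := by
  filter_upwards [hNB.ae_eq_natFloor (by positivity) ((div_lt_one (by linarith)).2 hc) t]
    with ω hω
  rw [timeChange, addDrift]
  congr 1
  rw [Real.toNNReal_add t.coe_nonneg (hω ▸ Nat.cast_nonneg _), Real.toNNReal_coe]
  nth_rw 1 [hω]
  rw [Real.toNNReal_natCast]

/-- No joint measurability of M in time and ω is needed: almost surely the random shift is a natural
number, so only countably many M(t + n) occur. -/
lemma aemeasurable_timeChange (hc : 1 < c) (hM : ∀ t, Measurable (M t))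
    (hNB : IsNegBinomialLevyProcess (1 / c) NB P) (t : ℝ≥0) :
    AEMeasurable (timeChange M (addDrift NB) t) P := by
  have hF : Measurable fun q : Ω × ℕ => M (t + (q.2 : ℝ≥0)) q.1 :=
    measurable_from_prod_countable_left fun n => hM (t + n)
  exact ⟨_, hF.comp (measurable_id.prodMk (hNB.isLevy.measurable t).nat_floor),
    timeChange_ae_eq hc hNB t⟩

/-- The joint Laplace transform of the increments of a Mittag-Leffler Lévy process that is time
changed by a negative binomial Lévy process with unit drift. -/
theorem IsMittagLefflerLevyProcess.lintegral_prod_exp_timeChange (hα : 0 < α) (hlam : 0 < lam)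
    (hc : 1 < c) (hM : IsMittagLefflerLevyProcess α lam M P)
    (hNB : IsNegBinomialLevyProcess (1 / c) NB P) (hind : IndepProcesses M (addDrift NB) P)
    {k : ℕ} {t : Fin (k + 1) → ℝ≥0} (ht : Monotone t) {u : Fin k → ℝ} (hu : 0 ≤ u) :
    ∫⁻ ω, ∏ i, ENNReal.ofReal (Real.exp (-u i *
        (timeChange M (addDrift NB) (t i.succ) ω -
          timeChange M (addDrift NB) (t i.castSucc) ω))) ∂P =
      ∏ i, ENNReal.ofReal (mittagLefflerBase α lam (c ^ (1 / α) * u i) ^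
        ((t i.succ : ℝ) - t i.castSucc)) := by
  have hp : 0 < 1 / c := by positivity
  have hp1 : 1 / c < 1 := (div_lt_one (by linarith)).2 hc
  -- A is the whole path of M, while B keeps only integer values of the clock on the grid. With B in
  -- a countable space, the functional F below is measurable as soon as it is so for each fixed
  -- value of B.
  set A : Ω → ℝ≥0 → ℝ := fun ω s => M s ω with hA
  set B : Ω → Fin (k + 1) → ℕ := fun ω i => ⌊NB (t i) ω⌋₊ with hB
  have hAm : Measurable A := measurable_pi_lambda _ hM.isLevy.measurable
  have hBm : Measurable B := measurable_pi_lambda _ fun i => (hNB.isLevy.measurable _).nat_floor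
  have hAB : IndepFun A B P := by
    have hφ : Measurable fun (f : ℝ≥0 → ℝ) (i : Fin (k + 1)) => ⌊f (t i) - t i⌋₊ :=
      measurable_pi_lambda _ fun i => ((measurable_pi_apply _).sub_const _).nat_floor
    have := IndepFun.comp hind measurable_id hφ
    have hcomp : (fun (f : ℝ≥0 → ℝ) (i : Fin (k + 1)) => ⌊f (t i) - t i⌋₊) ∘
        (fun ω s => addDrift NB s ω) = B := by
      ext ω i
      simp [hB, addDrift]
    rwa [hcomp] at this
  set F : (ℝ≥0 → ℝ) × (Fin (k + 1) → ℕ) → ENNReal := fun q => ∏ i : Fin k,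
    ENNReal.ofReal (Real.exp (-u i * (q.1 (t i.succ + (q.2 i.succ : ℝ≥0)) -
      q.1 (t i.castSucc + (q.2 i.castSucc : ℝ≥0))))) with hF
  have hFm : Measurable F := measurable_from_prod_countable_left fun n => by
    simp only [hF]
    fun_prop
  have hpos : ∀ i, 0 < mittagLefflerBase α lam (u i) := fun i => mittagLefflerBase_pos hlam (hu i)
  calc _ = ∫⁻ ω, F (A ω, B ω) ∂P := by
        refine lintegral_congr_ae ?_
        filter_upwards [ae_all_iff.2 fun i : Fin (k + 1) => timeChange_ae_eq (M := M) hc hNB (t i)]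
          with ω hω
        simp only [hω, hF, hA, hB]
    _ = ∫⁻ ω', ∫⁻ ω, F (A ω, B ω') ∂P ∂P := hAB.lintegral_comp_eq hAm hBm hFm
    _ = ∫⁻ ω', (∏ i, ENNReal.ofReal (mittagLefflerBase α lam (u i) ^
          ((t i.succ : ℝ) - t i.castSucc))) * ∏ i, ENNReal.ofReal
          (mittagLefflerBase α lam (u i) ^ (NB (t i.succ) ω' - NB (t i.castSucc) ω')) ∂P := by
        refine lintegral_congr_ae ?_
        filter_upwards [hNB.ae_monotone hp hp1,
          ae_all_iff.2 fun i : Fin (k + 1) => hNB.ae_eq_natFloor hp hp1 (t i)] with ω' hmono hfl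
        -- The frozen clock is again a monotone grid, so the transform of M's increments applies.
        -- Its exponents split into the drift part and the increments of NB.
        have hτ : Monotone fun i => t i + (B ω' i : ℝ≥0) := fun i j hij =>
          add_le_add (ht hij) (Nat.cast_le.2 (Nat.floor_mono (hmono (ht hij))))
        rw [← Finset.prod_mul_distrib]
        refine (hM.lintegral_prod_exp hτ hu).trans (Finset.prod_congr rfl fun i _ => ?_)
        rw [← ENNReal.ofReal_mul (Real.rpow_nonneg (hpos i).le _), ← Real.rpow_add (hpos i),
          hfl i.succ, hfl i.castSucc]
        congr 2
        simp only [hB, NNReal.coe_add, NNReal.coe_natCast]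
        ring
    _ = _ := by
        -- The drift factor is deterministic; the rest factors over the increments of NB into
        -- generating functions at the Mittag-Leffler bases.
        rw [lintegral_const_mul]
        · rw [hNB.isLevy.lintegral_prod_increments ht
            (g := fun i x => ENNReal.ofReal (mittagLefflerBase α lam (u i) ^ x))
            (fun i => by fun_prop), ← Finset.prod_mul_distrib]
          refine Finset.prod_congr rfl fun i _ => ?_
          have hle := mittagLefflerBase_le_one (α := α) hlam (hu i)
          have hden : 0 < 1 - (1 - 1 / c) * mittagLefflerBase α lam (u i) := by
            nlinarith [hpos i]
          rw [hNB.lintegral_rpow hp hp1 _ (hpos i) hle, NNReal.coe_sub (ht i.castSucc_le_succ),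
            ← ENNReal.ofReal_mul (Real.rpow_nonneg (hpos i).le _),
            ← Real.mul_rpow (hpos i).le (div_pos hp hden).le,
            mittagLefflerBase_scale hα.ne' hlam (by linarith) (hu i)]
        · have := hNB.isLevy.measurable
          fun_prop

end TimeChange

/-! ### From increments to finite-dimensional distributions -/

section FiniteDimensional

variable {Ω : Type*} [MeasurableSpace Ω] {P : Measure Ω}

/-- The map that recovers a finite sequence starting at `0` from its increments. -/
def partialSums {k : ℕ} (d : Fin k → ℝ) (i : Fin (k + 1)) : ℝ :=
  ∑ j : Fin k, if j.castSucc < i then d j else 0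

lemma partialSums_increments {k : ℕ} (x : Fin (k + 1) → ℝ) (h0 : x 0 = 0) :
    partialSums (fun j => x j.succ - x j.castSucc) = x := by
  ext i
  induction i using Fin.induction with
  | zero => simp [partialSums, h0]
  | succ i ih =>
    have hsplit : ∀ d : Fin k → ℝ, partialSums d i.succ = partialSums d i.castSucc + d i := by
      intro d
      have hi : d i = ∑ j : Fin k, if j = i then d j else 0 := by simp
      rw [partialSums, partialSums, hi, ← Finset.sum_add_distrib]
      refine Finset.sum_congr rfl fun j _ => ?_
      rcases lt_trichotomy j i with h | h | h
      · simp [Fin.castSucc_lt_succ_iff, h.le, h, h.ne]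
      · simp [h]
      · simp [Fin.castSucc_lt_succ_iff, h.not_ge, h.not_gt, h.ne']
    rw [hsplit, ih]
    ring

/-- Two processes that start at `0` have the same finite-dimensional distributions as soon as
their increments along monotone finite sequences of times starting at `0` do. -/
theorem sameFDD_of_increments {X Y : ℝ≥0 → Ω → ℝ} (hX : ∀ t, AEMeasurable (X t) P)
    (hY : ∀ t, AEMeasurable (Y t) P) (hX0 : ∀ᵐ ω ∂P, X 0 ω = 0) (hY0 : ∀ᵐ ω ∂P, Y 0 ω = 0)
    (h : ∀ (k : ℕ) (t : Fin (k + 1) → ℝ≥0), Monotone t →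
      IdentDistrib (fun ω (i : Fin k) => X (t i.succ) ω - X (t i.castSucc) ω)
        (fun ω (i : Fin k) => Y (t i.succ) ω - Y (t i.castSucc) ω) P P) :
    SameFDD X Y P := by
  intro I
  -- Time 0 is added to the grid because increments determine the values only once the starting
  -- value is known.
  obtain ⟨k, hk⟩ : ∃ k, (insert 0 I).card = k + 1 :=
    Nat.exists_eq_add_one.2 (Finset.card_pos.2 ⟨0, Finset.mem_insert_self _ _⟩)
  set e := (insert 0 I).orderIsoOfFin hk with he
  set t : Fin (k + 1) → ℝ≥0 := fun i => (e i : ℝ≥0) with ht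
  have htm : Monotone t := fun i j hij => e.monotone hij
  have ht0 : t 0 = 0 := by
    have : e 0 ≤ ⟨0, Finset.mem_insert_self _ _⟩ := by
      rw [← e.apply_symm_apply ⟨0, Finset.mem_insert_self _ _⟩]
      exact e.monotone (Fin.zero_le _)
    exact le_antisymm this zero_le
  set idx : I → Fin (k + 1) := fun s => e.symm ⟨s, Finset.mem_insert_of_mem s.2⟩ with hidx
  have htidx : ∀ s : I, t (idx s) = s := fun s => by simp [ht, hidx]
  set φ : (Fin k → ℝ) → I → ℝ := fun d s => partialSums d (idx s) with hφ
  have hφm : Measurable φ := by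
    refine measurable_pi_lambda _ fun s => Finset.measurable_sum _ fun j _ => ?_
    split_ifs <;> fun_prop
  have recover : ∀ Z : ℝ≥0 → Ω → ℝ, (∀ᵐ ω ∂P, Z 0 ω = 0) →
      φ ∘ (fun ω (i : Fin k) => Z (t i.succ) ω - Z (t i.castSucc) ω) =ᵐ[P]
        fun ω (s : I) => Z s ω := by
    intro Z hZ0
    filter_upwards [hZ0] with ω hω
    ext s
    simp only [hφ, Function.comp_apply]
    rw [partialSums_increments (fun i => Z (t i) ω) (by rw [ht0, hω])]
    exact congrArg (fun r => Z r ω) (htidx s)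
  refine ⟨aemeasurable_pi_lambda _ fun s => hX s, aemeasurable_pi_lambda _ fun s => hY s, ?_⟩
  rw [← Measure.map_congr (recover X hX0), ← Measure.map_congr (recover Y hY0)]
  exact ((h k t htm).comp hφm).map_eq

end FiniteDimensional

/-! ### Self-similarity -/

section Main

variable {Ω : Type*} [MeasurableSpace Ω] {P : Measure Ω} [IsProbabilityMeasure P]
  {α lam c : ℝ} {M NB : ℝ≥0 → Ω → ℝ}

/-- A Mittag-Leffler Lévy process, time changed by an independent negative binomial Lévy process
with unit drift, is a rescaled Mittag-Leffler Lévy process. -/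
theorem IsMittagLefflerLevyProcess.sameFDD_timeChange (hα : 0 < α) (hlam : 0 < lam)
    (hc : 1 < c) (hM : IsMittagLefflerLevyProcess α lam M P)
    (hNB : IsNegBinomialLevyProcess (1 / c) NB P) (hind : IndepProcesses M (addDrift NB) P) :
    SameFDD (timeChange M (addDrift NB)) (fun t ω => c ^ (1 / α) * M t ω) P := by
  have hXm := aemeasurable_timeChange hc hM.isLevy.measurable hNB
  have hYm : ∀ t, AEMeasurable (fun ω => c ^ (1 / α) * M t ω) P := fun t =>
    ((hM.isLevy.measurable t).const_mul _).aemeasurable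
  refine sameFDD_of_increments hXm hYm ?_ ?_ fun k t ht => ?_
  · filter_upwards [hM.isLevy.zero, hNB.isLevy.zero] with ω h1 h2
    simp [timeChange, addDrift, h1, h2]
  · filter_upwards [hM.isLevy.zero] with ω h1
    simp [h1]
  · refine identDistrib_of_lintegral_exp_eq
      (aemeasurable_pi_lambda _ fun i => (hXm _).sub (hXm _))
      (aemeasurable_pi_lambda _ fun i => (hYm _).sub (hYm _)) (fun u hu => ?_) fun u hu => ?_
    · have hcu : 0 ≤ fun i => c ^ (1 / α) * u i := fun i =>
        mul_nonneg (Real.rpow_nonneg (by linarith) _) (hu i)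
      rw [hM.lintegral_prod_exp_timeChange hα hlam hc hNB hind ht hu,
        -- The transform of M read backwards at the arguments c^(1/α) u; the constant then moves
        -- from the argument to the process.
        ← hM.lintegral_prod_exp ht hcu]
      refine lintegral_congr fun ω => Finset.prod_congr rfl fun i _ => ?_
      congr 2
      ring
    · rw [hM.lintegral_prod_exp_timeChange hα hlam hc hNB hind ht hu]
      refine Finset.prod_le_one' fun i _ => ?_
      have hcu : 0 ≤ c ^ (1 / α) * u i := mul_nonneg (Real.rpow_nonneg (by linarith) _) (hu i)
      rw [ENNReal.ofReal_le_one]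
      exact Real.rpow_le_one (mittagLefflerBase_pos hlam hcu).le
        (mittagLefflerBase_le_one hlam hcu)
        (sub_nonneg.2 (NNReal.coe_le_coe.2 (ht i.castSucc_le_succ)))

end Main

theorem mainTheorem4 {Ω : Type*} [MeasurableSpace Ω] (P : Measure Ω) [IsProbabilityMeasure P]
    (α lam : ℝ) (hα : 0 < α) (hα1 : α ≤ 1) (hlam : 0 < lam)
    (M : ℝ≥0 → Ω → ℝ) (hM : IsMittagLefflerLevyProcess α lam M P) :
    (∀ NB : ℝ → ℝ≥0 → Ω → ℝ,
      (∀ c, 1 < c → IsNegBinomialLevyProcess (1 / c) (NB c) P) →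
      (∀ c, 1 < c → IndepProcesses M (addDrift (NB c)) P) →
      IsStochSelfSimilar M (fun c => addDrift (NB c)) (1 / α) P) ∧
    (∀ (c : ℝ) (NB : ℝ≥0 → Ω → ℝ), 1 < c →
      IsNegBinomialLevyProcess (1 / c) NB P →
      IndepProcesses M (addDrift NB) P →
      SameFDD (timeChange M (addDrift NB)) (fun t ω => c ^ (1 / α) * M t ω) P) := by
  refine ⟨fun NB hNB hind => ?_, fun c NB hc hNB hind =>
    hM.sameFDD_timeChange hα hlam hc hNB hind⟩
  have hp : ∀ c : ℝ, 1 < c → 0 < 1 / c := fun c hc => by positivity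
  have hp1 : ∀ c : ℝ, 1 < c → 1 / c < 1 := fun c hc => (div_lt_one (by linarith)).2 hc
  refine ⟨by positivity, hM.isLevy.measurable, fun c hc t => ?_, hind, fun c hc => ?_,
    fun c hc => ?_, fun c hc t => ?_, fun c hc =>
    hM.sameFDD_timeChange hα hlam hc (hNB c hc) (hind c hc)⟩
  · exact ((hNB c hc).isLevy.measurable t).const_add _
  · filter_upwards [(hNB c hc).isLevy.zero] with ω hω
    simp [addDrift, hω]
  · filter_upwards [(hNB c hc).ae_monotone (hp c hc) (hp1 c hc)] with ω hω s t hst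
    exact add_le_add (NNReal.coe_le_coe.2 hst) (hω hst)
  · obtain ⟨h1, h2⟩ := (hNB c hc).integrable_and_integral (hp c hc) (hp1 c hc) t
    refine ⟨(integrable_const _).add h1, ?_⟩
    have : ∫ ω, addDrift (NB c) t ω ∂P = ∫ ω, ((t : ℝ) + NB c t ω) ∂P := rfl
    rw [this, integral_add (integrable_const _) h1, h2]
    have : c ≠ 0 := by positivity
    simp
    field_simp
    ring
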